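/- For a positive integer $n$ let $\mathrm{S}_n$ and $\mathrm{A}_n$ be the symmetric and the alternating group of degree $n$, and let $\log$ denote the natural logarithm. For $G\in\{\mathrm{A}_n,\mathrm{S}_n\}$ let $\rho_G$ be the proportion of permutations $g\in G$ such that some power of $g$ is a cycle (a permutation with exactly one cycle of length greater than $1$) whose length is a prime $p$ in the open interval $\left(\log n,\ (\log n)^{\log\log n}\right)$. Then there is an integer $N$ such that, for all $n\ge N$, $$\rho_{\mathrm{S}_n}\ \ge\ 1-\frac{5}{\log\log n}\qquad\text{and}\qquad \rho_{\mathrm{A}_n}\ \ge\ 1-\frac{7}{\log\log n}.$$ -/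

import Mathlib

/-- Some power of `g` is a `k`-cycle, i.e. a permutation with a single nontrivial cycle,
that cycle having length `k`. -/
def IsPreCycle {n : ℕ} (k : ℕ) (g : Equiv.Perm (Fin n)) : Prop :=
  ∃ m : ℕ, (g ^ m).IsCycle ∧ (g ^ m).support.card = k

/-- Some power of `g` is a cycle whose length is a prime in the open interval
`(log n, (log n) ^ (log log n))`. -/
def PowersToSmallPrimeCycle {n : ℕ} (g : Equiv.Perm (Fin n)) : Prop :=
  ∃ p : ℕ, p.Prime ∧ Real.log n < p ∧
    (p : ℝ) < Real.log n ^ Real.log (Real.log n) ∧ IsPreCycle p g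

/-- The proportion of elements of the permutation group `G` of degree `n` that have some power
equal to a cycle of prime length in `(log n, (log n) ^ (log log n))`. -/
noncomputable def rho {n : ℕ} (G : Subgroup (Equiv.Perm (Fin n))) : ℝ :=
  (Nat.card {g : G // PowersToSmallPrimeCycle (g : Equiv.Perm (Fin n))} : ℝ) / (Nat.card G : ℝ)

/-!
Put `L = log log n`. A permutation has a power that is a `p`-cycle as soon as exactly one of its
cycles has length divisible by the prime `p`, and this cycle has length `p`
(`isPreCycle_of_hasUniqueMultiple`). Only the primes `u < p ≤ v` are used, where `u` is about
`L² log n` and `v` is about `(log n) ^ L = exp (L²)`. A permutation that is bad for all of them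
falls into one of two classes.

* It has no cycle whose length is such a prime. If `a_m` is the proportion of permutations of `m`
  points without cycle lengths in a set `A`, then counting the points of a permutation by the length
  of the cycle through them gives `m a_m ≤ ∑_{k ≤ m, k ∉ A} a_{m-k}` (`mul_avoidProp_le`). Comparing
  the generating function of `a` with `exp (∑_{k ∉ A} x ^ k / k)` gives
  `a_n ≤ e * exp (-∑_{k ∈ A} 1/k)` (`avoidProp_le`). By Mertens' second theorem
  (`exists_le_sum_inv_primes`), the sum of `1/p` over `u < p ≤ v` is at least
  `log (log v / log u) - o(1) = log L - o(1)`, so this class has proportion at most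
  `(e + o(1)) / L`.
* It has a `p`-cycle together with another cycle of length divisible by `p`. The expected number of
  such pairs is at most `(1 + log n) / p²` (`permAvg_exists_mem_erase_dvd_le`); summed over `p > u`
  this is at most `(1 + log n) / u = O(1 / L²)`. This is why the primes just above `log n` are left
  out.

Since `e < 7/2`, the bad permutations number at most `(7/2) n! / L` for large `n`. This proves the
bound for the symmetric group, and, the alternating group having index two, also the bound for it.

Averages over permutations are computed through the cycle type: by the formula for the size of a
conjugacy class, marking a `k`-cycle and removing it turns an average over `n` points into `1/k`
times an average over `n - k` points (`permAvg_count_mul_erase`).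
-/

open Finset

/-! ### Mertens' theorems -/

theorem log_factorial_eq_sum_primesLE (n : ℕ) :
    Real.log (n.factorial : ℝ) =
      ∑ p ∈ Nat.primesLE n, (n.factorial.factorization p : ℝ) * Real.log p := by
  rw [Real.log_nat_eq_sum_factorization, Finsupp.sum]
  refine Finset.sum_subset (fun p hp => ?_) (fun p _ hp => ?_)
  · rw [Nat.support_factorization, Nat.mem_primeFactors] at hp
    rw [Nat.mem_primesLE]
    exact ⟨(hp.1.dvd_factorial).1 hp.2.1, hp.1⟩
  · rw [Finsupp.notMem_support_iff] at hp
    simp [hp]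

theorem div_sub_one_le_factorization_factorial {n p : ℕ} (hp : p.Prime) (hpn : p ≤ n) :
    (n : ℝ) / p - 1 ≤ n.factorial.factorization p := by
  have h1 : n / p ≤ n.factorial.factorization p := by
    rw [Nat.factorization_factorial hp (Nat.lt_succ_self _)]
    have h := Finset.single_le_sum (f := fun i => n / p ^ i) (s := Ico 1 (Nat.log p n).succ)
      (fun _ _ => Nat.zero_le _) (a := 1)
      (by simpa using Nat.log_pos hp.one_lt hpn)
    simpa using h
  have h2 : (n : ℝ) / p < (n / p : ℕ) + 1 := by
    rw [← Nat.floor_div_eq_div (K := ℝ)]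
    exact Nat.lt_floor_add_one _
  have h3 : ((n / p : ℕ) : ℝ) ≤ n.factorial.factorization p := by exact_mod_cast h1
  linarith

theorem factorization_factorial_le_div {n p : ℕ} (hp : p.Prime) :
    (n.factorial.factorization p : ℝ) ≤ (n : ℝ) / (p - 1) := by
  have h1 := Nat.factorization_factorial_le_div_pred hp n
  have h2 : ((n.factorial.factorization p : ℕ) : ℝ) ≤ ((n / (p - 1) : ℕ) : ℝ) := by
    exact_mod_cast h1
  refine h2.trans (Nat.cast_div_le.trans ?_)
  rw [Nat.cast_sub hp.one_le, Nat.cast_one]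

theorem mul_log_sub_le_log_factorial (n : ℕ) :
    (n : ℝ) * Real.log n - n ≤ Real.log (n.factorial : ℝ) := by
  rcases Nat.eq_zero_or_pos n with rfl | hn
  · simp
  have hn' : (0 : ℝ) < n := by exact_mod_cast hn
  have h := Real.pow_div_factorial_le_exp (x := n) hn'.le n
  have h2 := Real.log_le_log (by positivity) h
  rw [Real.log_exp, Real.log_div (by positivity) (by positivity), Real.log_pow] at h2
  linarith

theorem log_factorial_le_mul_log (n : ℕ) :
    Real.log (n.factorial : ℝ) ≤ (n : ℝ) * Real.log n := by
  rw [← Real.log_pow]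
  exact Real.log_le_log (by positivity) (by exact_mod_cast Nat.factorial_le_pow n)

/-- The partial sums of `log p / p` over the primes `p ≤ n`. -/
noncomputable def sumLogDiv (n : ℕ) : ℝ := ∑ p ∈ Nat.primesLE n, Real.log p / p

theorem sumLogDiv_le {n : ℕ} (hn : 0 < n) : sumLogDiv n ≤ Real.log n + Real.log 4 := by
  have hn' : (0 : ℝ) < n := by exact_mod_cast hn
  have h1 : ∑ p ∈ Nat.primesLE n, ((n : ℝ) / p - 1) * Real.log p ≤ n * Real.log n := by
    refine le_trans ?_ (log_factorial_le_mul_log n)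
    rw [log_factorial_eq_sum_primesLE]
    refine Finset.sum_le_sum fun p hp => ?_
    exact mul_le_mul_of_nonneg_right (div_sub_one_le_factorization_factorial
      (Nat.prime_of_mem_primesLE hp) (Nat.le_of_mem_primesLE hp)) (Real.log_natCast_nonneg p)
  have h2 : ∑ p ∈ Nat.primesLE n, ((n : ℝ) / p - 1) * Real.log p
      = n * sumLogDiv n - Chebyshev.theta n := by
    rw [Chebyshev.theta_eq_sum_primesLE_log, sumLogDiv, Finset.mul_sum, ← Finset.sum_sub_distrib]
    exact Finset.sum_congr rfl fun p _ => by ring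
  have h3 := Chebyshev.theta_le_log4_mul_x hn'.le
  have h4 : (n : ℝ) * sumLogDiv n ≤ n * (Real.log n + Real.log 4) := by linarith
  exact le_of_mul_le_mul_left h4 hn'

theorem log_div_mul_sub_one_le {k : ℕ} (hk : 2 ≤ k) :
    Real.log k / (k * (k - 1)) ≤ 4 * ((k : ℝ) ^ (3 / 2 : ℝ))⁻¹ := by
  have hk' : (2 : ℝ) ≤ k := by exact_mod_cast hk
  have h0 : (0 : ℝ) < k := by linarith
  have h1 : Real.log k ≤ 2 * (k : ℝ) ^ (1 / 2 : ℝ) := by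
    have := Real.log_le_rpow_div h0.le (ε := 1 / 2) (by norm_num)
    linarith
  have h2 : (k : ℝ) ^ (3 / 2 : ℝ) * (k : ℝ) ^ (1 / 2 : ℝ) = (k : ℝ) ^ 2 := by
    rw [← Real.rpow_add h0]; norm_num
  have h3 : 0 < (k : ℝ) ^ (3 / 2 : ℝ) := by positivity
  rw [← div_eq_mul_inv, div_le_div_iff₀ (by nlinarith) h3]
  calc Real.log k * (k : ℝ) ^ (3 / 2 : ℝ)
      ≤ 2 * (k : ℝ) ^ (1 / 2 : ℝ) * (k : ℝ) ^ (3 / 2 : ℝ) := by gcongr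
    _ = 2 * (k : ℝ) ^ 2 := by rw [← h2]; ring
    _ ≤ 4 * (k * (k - 1)) := by nlinarith

theorem exists_le_sumLogDiv : ∃ C : ℝ, ∀ n : ℕ, 0 < n → Real.log n - C ≤ sumLogDiv n := by
  have hsum : Summable fun k : ℕ => 4 * ((k : ℝ) ^ (3 / 2 : ℝ))⁻¹ :=
    (Real.summable_nat_rpow_inv.2 (by norm_num)).mul_left 4
  refine ⟨1 + ∑' k : ℕ, 4 * ((k : ℝ) ^ (3 / 2 : ℝ))⁻¹, fun n hn => ?_⟩
  have hn' : (0 : ℝ) < n := by exact_mod_cast hn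
  have h1 : (n : ℝ) * Real.log n - n ≤
      n * ∑ p ∈ Nat.primesLE n, (Real.log p / p + Real.log p / (p * (p - 1))) := by
    refine (mul_log_sub_le_log_factorial n).trans ?_
    rw [log_factorial_eq_sum_primesLE, Finset.mul_sum]
    refine Finset.sum_le_sum fun p hp => ?_
    have hp2 : (2 : ℝ) ≤ p := by exact_mod_cast Nat.two_le_of_mem_primesLE hp
    calc (n.factorial.factorization p : ℝ) * Real.log p
        ≤ (n : ℝ) / (p - 1) * Real.log p :=
          mul_le_mul_of_nonneg_right (factorization_factorial_le_div
            (Nat.prime_of_mem_primesLE hp)) (Real.log_natCast_nonneg p)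
      _ = _ := by
          have : (p : ℝ) - 1 ≠ 0 := by linarith
          have : (p : ℝ) ≠ 0 := by linarith
          field_simp
          ring
  have h2 : ∑ p ∈ Nat.primesLE n, Real.log p / (p * (p - 1)) ≤
      ∑' k : ℕ, 4 * ((k : ℝ) ^ (3 / 2 : ℝ))⁻¹ := by
    refine le_trans (Finset.sum_le_sum fun p hp =>
      log_div_mul_sub_one_le (Nat.two_le_of_mem_primesLE hp)) ?_
    exact hsum.sum_le_tsum _ fun _ _ => by positivity
  rw [Finset.sum_add_distrib] at h1
  have h3 : (n : ℝ) * (Real.log n - 1) ≤ n * (sumLogDiv n +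
      ∑ p ∈ Nat.primesLE n, Real.log p / (p * (p - 1))) := by
    rw [sumLogDiv]; linarith
  have h4 := le_of_mul_le_mul_left h3 hn'
  linarith

theorem log_succ_sub_log_le {k : ℕ} (hk : 0 < k) :
    Real.log (k + 1 : ℕ) - Real.log k ≤ 1 := by
  have hk' : (1 : ℝ) ≤ k := by exact_mod_cast hk
  have h0 : (0 : ℝ) < k := by linarith
  rw [← Real.log_div (by positivity) (by positivity)]
  have h := Real.log_le_sub_one_of_pos (x := ((k + 1 : ℕ) : ℝ) / k) (by positivity)
  have h1 : ((k + 1 : ℕ) : ℝ) / k ≤ 2 := by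
    rw [div_le_iff₀ h0]; push_cast; linarith
  linarith

theorem log_log_succ_sub_le {k : ℕ} (hk : 2 ≤ k) :
    Real.log (Real.log (k + 1 : ℕ)) - Real.log (Real.log k) ≤
      (Real.log (k + 1 : ℕ) - Real.log k) / Real.log k := by
  have h0 : 0 < Real.log k := Real.log_pos (by exact_mod_cast hk)
  have h1 : 0 < Real.log (k + 1 : ℕ) := Real.log_pos (by exact_mod_cast (by omega : 1 < k + 1))
  rw [← Real.log_div h1.ne' h0.ne', sub_div, div_self h0.ne']
  exact Real.log_le_sub_one_of_pos (by positivity)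

/-- Passing from `n` to `n + 1` increases `∑_{p ≤ n} 1/p - log log n` by at least the increment of
`(∑_{p ≤ n} log p / p - log n + c) / log n`: this is discrete partial summation, and it holds for
every constant `c` with `∑_{p ≤ n} log p / p ≥ log n - c + 1`. -/
theorem monotone_step_sum_inv_primes {c : ℝ}
    (hc : ∀ n : ℕ, 0 < n → Real.log n - c + 1 ≤ sumLogDiv n) {k : ℕ} (hk : 2 ≤ k) :
    ∑ p ∈ Nat.primesLE k, (p : ℝ)⁻¹ - Real.log (Real.log k)
        - (sumLogDiv k - Real.log k + c) / Real.log k ≤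
      ∑ p ∈ Nat.primesLE (k + 1), (p : ℝ)⁻¹ - Real.log (Real.log (k + 1 : ℕ))
        - (sumLogDiv (k + 1) - Real.log (k + 1 : ℕ) + c) / Real.log (k + 1 : ℕ) := by
  have h0 : 0 < Real.log k := Real.log_pos (by exact_mod_cast hk)
  have h1 : 0 < Real.log (k + 1 : ℕ) := Real.log_pos (by exact_mod_cast (by omega : 1 < k + 1))
  have h01 : Real.log k ≤ Real.log (k + 1 : ℕ) :=
    Real.log_le_log (by positivity) (by push_cast; linarith)
  have hd := log_succ_sub_log_le (k := k) (by omega)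
  have hll := log_log_succ_sub_le hk
  have hS := hc k (by omega)
  -- A prime `k + 1` contributes `1 / (k + 1)` to both sums once the second is divided by the log.
  have key : (sumLogDiv (k + 1) - sumLogDiv k) / Real.log (k + 1 : ℕ) =
      ∑ p ∈ Nat.primesLE (k + 1), (p : ℝ)⁻¹ - ∑ p ∈ Nat.primesLE k, (p : ℝ)⁻¹ := by
    unfold sumLogDiv
    rw [Nat.primesLE_succ]
    split_ifs with hp
    · rw [Finset.sum_insert (Nat.notMem_primesLE k), Finset.sum_insert (Nat.notMem_primesLE k)]
      field_simp
      ring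
    · simp
  have hinv : (Real.log (k + 1 : ℕ))⁻¹ ≤ (Real.log k)⁻¹ := inv_anti₀ h0 h01
  have hprod : 0 ≤ ((Real.log k)⁻¹ - (Real.log (k + 1 : ℕ))⁻¹) *
      (sumLogDiv k - Real.log k + c - (Real.log (k + 1 : ℕ) - Real.log k)) :=
    mul_nonneg (by linarith) (by linarith)
  have e1 : Real.log (k + 1 : ℕ) * (Real.log (k + 1 : ℕ))⁻¹ = 1 := mul_inv_cancel₀ h1.ne'
  rw [div_eq_mul_inv] at key hll ⊢
  rw [div_eq_mul_inv]
  nlinarith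

/-- **Mertens' second theorem**, as a lower bound for the primes in an interval. -/
theorem exists_le_sum_inv_primes : ∃ C : ℝ, 0 < C ∧ ∀ u v : ℕ, 2 ≤ u → u ≤ v →
    Real.log (Real.log v) - Real.log (Real.log u) - C / Real.log u ≤
      ∑ p ∈ (Ioc u v).filter Nat.Prime, (p : ℝ)⁻¹ := by
  obtain ⟨C₀, hC₀⟩ := exists_le_sumLogDiv
  set c : ℝ := |C₀| + 1 with hcdef
  have hc : ∀ n : ℕ, 0 < n → Real.log n - c + 1 ≤ sumLogDiv n := fun n hn => by
    have := hC₀ n hn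
    have := le_abs_self C₀
    linarith
  have h4 : 0 < Real.log 4 := Real.log_pos (by norm_num)
  refine ⟨Real.log 4 + c, by positivity, fun u v hu huv => ?_⟩
  have hmono : ∑ p ∈ Nat.primesLE u, (p : ℝ)⁻¹ - Real.log (Real.log u)
        - (sumLogDiv u - Real.log u + c) / Real.log u ≤
      ∑ p ∈ Nat.primesLE v, (p : ℝ)⁻¹ - Real.log (Real.log v)
        - (sumLogDiv v - Real.log v + c) / Real.log v := by
    induction v, huv using Nat.le_induction with
    | base => exact le_rfl
    | succ k hk ih => exact ih.trans (monotone_step_sum_inv_primes hc (hu.trans hk))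
  have hlu : 0 < Real.log u := Real.log_pos (by exact_mod_cast hu)
  have hlv : 0 < Real.log v := Real.log_pos (by exact_mod_cast hu.trans huv)
  have h1 : 0 ≤ (sumLogDiv v - Real.log v + c) / Real.log v :=
    div_nonneg (by linarith [hc v (by omega)]) hlv.le
  have h2 : (sumLogDiv u - Real.log u + c) / Real.log u ≤ (Real.log 4 + c) / Real.log u := by
    gcongr
    linarith [sumLogDiv_le (n := u) (by omega)]
  have h3 : ∑ p ∈ Nat.primesLE v, (p : ℝ)⁻¹ = ∑ p ∈ Nat.primesLE u, (p : ℝ)⁻¹ +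
      ∑ p ∈ (Ioc u v).filter Nat.Prime, (p : ℝ)⁻¹ := by
    rw [← Finset.sum_union]
    · congr 1
      ext p
      simp only [Nat.mem_primesLE, mem_union, mem_filter, mem_Ioc]
      constructor
      · rintro ⟨h, hp⟩
        rcases le_or_gt p u with h' | h'
        · exact Or.inl ⟨h', hp⟩
        · exact Or.inr ⟨⟨h', h⟩, hp⟩
      · rintro (⟨h, hp⟩ | ⟨⟨_, h⟩, hp⟩)
        · exact ⟨h.trans huv, hp⟩
        · exact ⟨h, hp⟩
    · rw [Finset.disjoint_left]
      intro p hp hp'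
      simp only [Nat.mem_primesLE, mem_filter, mem_Ioc] at hp hp'
      omega
  linarith

/-! ### Averages over the symmetric group of functions of the cycle type -/

/-- The set of cycle types (with fixed points omitted) of permutations of `n` points. -/
def cycleTypes (n : ℕ) : Finset (Multiset ℕ) :=
  (univ : Finset (Equiv.Perm (Fin n))).image Equiv.Perm.cycleType

/-- The average over `Perm (Fin n)` of a function of the cycle type. -/
noncomputable def permAvg (n : ℕ) (f : Multiset ℕ → ℝ) : ℝ :=
  (∑ σ : Equiv.Perm (Fin n), f σ.cycleType) / n.factorial

/-- The proportion of permutations of `n` points with cycle type `m`, provided there are any. -/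
noncomputable def cycleTypeWeight (n : ℕ) (m : Multiset ℕ) : ℝ :=
  (((n - m.sum).factorial * m.prod * ∏ k ∈ m.toFinset, (m.count k).factorial : ℕ) : ℝ)⁻¹

theorem mem_cycleTypes {n : ℕ} {m : Multiset ℕ} :
    m ∈ cycleTypes n ↔ m.sum ≤ n ∧ ∀ a ∈ m, 2 ≤ a := by
  have h := Equiv.Perm.exists_with_cycleType_iff (Fin n) (m := m)
  rw [Fintype.card_fin] at h
  rw [← h, cycleTypes]
  simp

theorem permAvg_eq_sum (n : ℕ) (f : Multiset ℕ → ℝ) :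
    permAvg n f = ∑ m ∈ cycleTypes n, cycleTypeWeight n m * f m := by
  have h := Finset.sum_comp (s := (univ : Finset (Equiv.Perm (Fin n)))) f Equiv.Perm.cycleType
  rw [permAvg, h, Finset.sum_div]
  refine Finset.sum_congr rfl fun m hm => ?_
  have hm' := mem_cycleTypes.1 hm
  have hc := Equiv.Perm.card_of_cycleType_mul_eq (Fin n) m
  rw [Fintype.card_fin, if_pos hm'] at hc
  have hc' : ((#{g : Equiv.Perm (Fin n) | g.cycleType = m} : ℕ) : ℝ) *
      (((n - m.sum).factorial * m.prod * ∏ k ∈ m.toFinset, (m.count k).factorial : ℕ) : ℝ) =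
      n.factorial := by exact_mod_cast hc
  have hn : (n.factorial : ℝ) ≠ 0 := by positivity
  have hd : (((n - m.sum).factorial * m.prod *
      ∏ k ∈ m.toFinset, (m.count k).factorial : ℕ) : ℝ) ≠ 0 := fun h0 => by
    rw [h0, mul_zero] at hc'
    exact hn hc'.symm
  rw [nsmul_eq_mul, cycleTypeWeight, ← hc']
  have ha : ((#{g : Equiv.Perm (Fin n) | g.cycleType = m} : ℕ) : ℝ) ≠ 0 := fun h0 => by
    rw [h0, zero_mul] at hc'
    exact hn hc'.symm
  field_simp

theorem permAvg_mono {n : ℕ} {f g : Multiset ℕ → ℝ} (h : ∀ m ∈ cycleTypes n, f m ≤ g m) :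
    permAvg n f ≤ permAvg n g := by
  unfold permAvg
  gcongr with σ
  exact h _ (mem_image_of_mem _ (mem_univ σ))

theorem permAvg_nonneg {n : ℕ} {f : Multiset ℕ → ℝ} (h : ∀ m, 0 ≤ f m) : 0 ≤ permAvg n f :=
  div_nonneg (Finset.sum_nonneg fun _ _ => h _) (by positivity)

theorem permAvg_add (n : ℕ) (f g : Multiset ℕ → ℝ) :
    permAvg n (fun m => f m + g m) = permAvg n f + permAvg n g := by
  simp [permAvg, Finset.sum_add_distrib, add_div]

theorem permAvg_const_mul (n : ℕ) (c : ℝ) (f : Multiset ℕ → ℝ) :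
    permAvg n (fun m => c * f m) = c * permAvg n f := by
  simp [permAvg, Finset.mul_sum, mul_div_assoc, Finset.sum_div]

theorem permAvg_sum {ι : Type*} (n : ℕ) (s : Finset ι) (f : ι → Multiset ℕ → ℝ) :
    permAvg n (fun m => ∑ i ∈ s, f i m) = ∑ i ∈ s, permAvg n (f i) := by
  unfold permAvg
  rw [Finset.sum_comm, Finset.sum_div]

theorem permAvg_one (n : ℕ) : permAvg n (fun _ => 1) = 1 := by
  have : (n.factorial : ℝ) ≠ 0 := by positivity
  simp [permAvg, Fintype.card_perm, this]

theorem cycleTypeWeight_cons {n k : ℕ} (hk : k ≠ 0) (m : Multiset ℕ) :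
    cycleTypeWeight n (k ::ₘ m) * (m.count k + 1) = (k : ℝ)⁻¹ * cycleTypeWeight (n - k) m := by
  have h1 : ∏ j ∈ (k ::ₘ m).toFinset, ((k ::ₘ m).count j).factorial =
      (m.count k + 1) * ∏ j ∈ m.toFinset, (m.count j).factorial := by
    have h2 : ∏ j ∈ m.toFinset, (m.count j).factorial =
        ∏ j ∈ insert k m.toFinset, (m.count j).factorial := by
      refine Finset.prod_subset (Finset.subset_insert _ _) fun j _ hj => ?_
      rw [Multiset.mem_toFinset] at hj
      simp [Multiset.count_eq_zero_of_notMem hj]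
    rw [h2, Multiset.toFinset_cons, ← Finset.mul_prod_erase _ _ (Finset.mem_insert_self k _),
      ← Finset.mul_prod_erase _ (fun j => (m.count j).factorial) (Finset.mem_insert_self k _),
      Multiset.count_cons_self, Nat.factorial_succ, mul_assoc]
    congr 2
    refine Finset.prod_congr rfl fun j hj => ?_
    rw [Multiset.count_cons_of_ne (Finset.ne_of_mem_erase hj)]
  have h3 : n - (k ::ₘ m).sum = n - k - m.sum := by rw [Multiset.sum_cons]; omega
  have hk' : (k : ℝ) ≠ 0 := by exact_mod_cast hk
  have hc : ((m.count k : ℝ) + 1) ≠ 0 := by positivity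
  rw [cycleTypeWeight, cycleTypeWeight, h1, h3, Multiset.prod_cons]
  push_cast
  rw [mul_inv, mul_inv, mul_inv, mul_inv, mul_inv, mul_inv]
  field_simp

/-- Removing a marked `k`-cycle from a permutation of `n` points leaves a permutation of `n - k`
points, and each of these arises from a `1/k` share of the marked permutations. -/
theorem permAvg_count_mul_erase {n k : ℕ} (hk : 2 ≤ k) (hkn : k ≤ n) (f : Multiset ℕ → ℝ) :
    permAvg n (fun m => m.count k * f (m.erase k)) = (k : ℝ)⁻¹ * permAvg (n - k) f := by
  rw [permAvg_eq_sum, permAvg_eq_sum, Finset.mul_sum]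
  have himg : (cycleTypes (n - k)).image (fun m => k ::ₘ m) ⊆ cycleTypes n := by
    intro m hm
    obtain ⟨m', hm', rfl⟩ := Finset.mem_image.1 hm
    rw [mem_cycleTypes] at hm' ⊢
    refine ⟨by rw [Multiset.sum_cons]; omega, fun a ha => ?_⟩
    rcases Multiset.mem_cons.1 ha with rfl | ha
    · exact hk
    · exact hm'.2 a ha
  rw [← Finset.sum_subset himg]
  · rw [Finset.sum_image fun a _ b _ h => (Multiset.cons_inj_right k).1 h]
    refine Finset.sum_congr rfl fun m _ => ?_
    rw [← mul_assoc (k : ℝ)⁻¹, ← cycleTypeWeight_cons (by omega), Multiset.count_cons_self,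
      Multiset.erase_cons_head]
    push_cast
    ring
  · intro m hm hm'
    have hkm : k ∉ m := fun hkm => hm' <| by
      refine Finset.mem_image.2 ⟨m.erase k, ?_, Multiset.cons_erase hkm⟩
      rw [mem_cycleTypes] at hm ⊢
      have hs := Multiset.sum_erase hkm
      exact ⟨by omega, fun a ha => hm.2 a (Multiset.mem_of_mem_erase ha)⟩
    simp [Multiset.count_eq_zero_of_notMem hkm]

/-- The analogue of `permAvg_count_mul_erase` for fixed points, which the cycle type omits: a
permutation of `n + 1` points with cycle type `m` has `n + 1 - m.sum` of them. -/
theorem permAvg_fixedPoints_mul (n : ℕ) (f : Multiset ℕ → ℝ) :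
    permAvg (n + 1) (fun m => ((n + 1 : ℕ) - m.sum : ℝ) * f m) = permAvg n f := by
  rw [permAvg_eq_sum, permAvg_eq_sum]
  have hsub : cycleTypes n ⊆ cycleTypes (n + 1) := fun m hm => by
    rw [mem_cycleTypes] at hm ⊢
    exact ⟨by omega, hm.2⟩
  rw [← Finset.sum_subset hsub]
  · refine Finset.sum_congr rfl fun m hm => ?_
    rw [mem_cycleTypes] at hm
    have h1 : n + 1 - m.sum = (n - m.sum) + 1 := by omega
    have h2 : ((n + 1 : ℕ) : ℝ) - m.sum = ((n - m.sum : ℕ) : ℝ) + 1 := by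
      rw [Nat.cast_sub hm.1]; push_cast; ring
    have h3 : ((n - m.sum : ℕ) : ℝ) + 1 ≠ 0 := by positivity
    rw [h2, cycleTypeWeight, cycleTypeWeight, h1, Nat.factorial_succ]
    push_cast [-Nat.cast_sub]
    rw [mul_inv, mul_inv, mul_inv, mul_inv, mul_inv]
    field_simp
  · intro m hm hm'
    rw [mem_cycleTypes] at hm hm'
    have h1 : m.sum = n + 1 := by
      by_contra h
      exact hm' ⟨by omega, hm.2⟩
    rw [h1]; simp

theorem permAvg_count_le {k : ℕ} (n : ℕ) (hk : 2 ≤ k) :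
    permAvg n (fun m => m.count k) ≤ (k : ℝ)⁻¹ := by
  rcases le_or_gt k n with hkn | hkn
  · have h := permAvg_count_mul_erase hk hkn (fun _ => 1)
    simp only [mul_one, permAvg_one] at h
    exact h.le
  · calc permAvg n (fun m => m.count k) ≤ permAvg n (fun m => 0 * m.count k) := by
          refine permAvg_mono fun m hm => ?_
          have : k ∉ m := fun hkm => by
            have := Multiset.single_le_sum (fun _ _ => Nat.zero_le _) _ hkm
            have := (mem_cycleTypes.1 hm).1
            omega
          simp [Multiset.count_eq_zero_of_notMem this]
      _ = 0 := by rw [permAvg_const_mul, zero_mul]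
      _ ≤ _ := by positivity

/-! ### Permutations without cycles of prescribed lengths -/

theorem sum_mul_pow_le_of_convolution_le {p : ℕ → ℝ} {A : Finset ℕ} (hp : ∀ m, 0 ≤ p m)
    (hrec : ∀ m, 0 < m → m * p m ≤ ∑ k ∈ Icc 1 m \ A, p (m - k)) (N : ℕ) {x : ℝ} (hx : 0 ≤ x) :
    ∑ m ∈ range (N + 1), m * p m * x ^ m ≤
      (∑ k ∈ Icc 1 N \ A, x ^ k) * ∑ m ∈ range (N + 1), p m * x ^ m := by
  calc ∑ m ∈ range (N + 1), m * p m * x ^ m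
      ≤ ∑ m ∈ range (N + 1), ∑ k ∈ Icc 1 N \ A, if k ≤ m then p (m - k) * x ^ m else 0 := by
        refine Finset.sum_le_sum fun m hm => ?_
        rcases Nat.eq_zero_or_pos m with rfl | hm0
        · simp only [Nat.cast_zero, zero_mul]
          exact Finset.sum_nonneg fun k _ => by
            split_ifs
            · exact mul_nonneg (hp _) (by positivity)
            · exact le_rfl
        · rw [← Finset.sum_filter]
          calc m * p m * x ^ m ≤ (∑ k ∈ Icc 1 m \ A, p (m - k)) * x ^ m :=
                mul_le_mul_of_nonneg_right (hrec m hm0) (by positivity)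
            _ = ∑ k ∈ Icc 1 m \ A, p (m - k) * x ^ m := by rw [Finset.sum_mul]
            _ ≤ _ := by
                refine le_of_eq (Finset.sum_congr ?_ fun _ _ => rfl)
                ext k
                simp only [mem_range, mem_sdiff, mem_Icc, mem_filter] at hm ⊢
                constructor
                · rintro ⟨⟨h1, h2⟩, h3⟩
                  exact ⟨⟨⟨h1, by omega⟩, h3⟩, h2⟩
                · rintro ⟨⟨⟨h1, _⟩, h3⟩, h2⟩
                  exact ⟨⟨h1, h2⟩, h3⟩
    _ = ∑ k ∈ Icc 1 N \ A, ∑ m ∈ range (N + 1), if k ≤ m then p (m - k) * x ^ m else 0 :=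
        Finset.sum_comm
    _ ≤ ∑ k ∈ Icc 1 N \ A, x ^ k * ∑ m ∈ range (N + 1), p m * x ^ m := by
        refine Finset.sum_le_sum fun k _ => ?_
        have h1 : (range (N + 1)).filter (fun m => k ≤ m) = Ico k (N + 1) := by
          ext m
          simp only [mem_filter, mem_range, mem_Ico]
          tauto
        rw [← Finset.sum_filter, h1, Finset.sum_Ico_eq_sum_range, Finset.mul_sum]
        calc ∑ i ∈ range (N + 1 - k), p (k + i - k) * x ^ (k + i)
            = ∑ i ∈ range (N + 1 - k), x ^ k * (p i * x ^ i) := by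
              refine Finset.sum_congr rfl fun i _ => ?_
              rw [Nat.add_sub_cancel_left, pow_add]
              ring
          _ ≤ _ := by
              refine Finset.sum_le_sum_of_subset_of_nonneg ?_ fun i _ _ => ?_
              · exact Finset.range_subset_range.2 (Nat.sub_le _ _)
              · have := hp i
                positivity
    _ = _ := by rw [Finset.sum_mul]

/-- The recursion says that the generating function `F` of `p` satisfies
`x F' ≤ (∑_{k ∉ A} x ^ k) F`, so that `F(x) exp (-∑_{k ∉ A} x ^ k / k)` is antitone. Comparing its
values at `0` and `1` bounds the sum of the coefficients. -/
theorem sum_le_exp_of_convolution_le {p : ℕ → ℝ} {A : Finset ℕ} (hp : ∀ m, 0 ≤ p m)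
    (hp0 : p 0 = 1) (hrec : ∀ m, 0 < m → m * p m ≤ ∑ k ∈ Icc 1 m \ A, p (m - k)) (N : ℕ) :
    ∑ m ∈ range (N + 1), p m ≤ Real.exp (∑ k ∈ Icc 1 N \ A, (k : ℝ)⁻¹) := by
  set F : ℝ → ℝ := fun x => ∑ m ∈ range (N + 1), p m * x ^ m with hF
  set G : ℝ → ℝ := fun x => ∑ k ∈ Icc 1 N \ A, x ^ k * (k : ℝ)⁻¹ with hG
  have hF' : ∀ x, HasDerivAt F (∑ m ∈ range (N + 1), p m * (m * x ^ (m - 1))) x := fun x =>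
    HasDerivAt.fun_sum fun m _ => (hasDerivAt_pow m x).const_mul (p m)
  have hG' : ∀ x, HasDerivAt G (∑ k ∈ Icc 1 N \ A, k * x ^ (k - 1) * (k : ℝ)⁻¹) x := fun x =>
    HasDerivAt.fun_sum fun k _ => (hasDerivAt_pow k x).mul_const _
  have hH' : ∀ x, HasDerivAt (fun x => F x * Real.exp (-G x))
      ((∑ m ∈ range (N + 1), p m * (m * x ^ (m - 1))) * Real.exp (-G x) +
        F x * (Real.exp (-G x) * -(∑ k ∈ Icc 1 N \ A, k * x ^ (k - 1) * (k : ℝ)⁻¹))) x := fun x =>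
    (hF' x).mul (hG' x).neg.exp
  have hanti : AntitoneOn (fun x => F x * Real.exp (-G x)) (Set.Icc 0 1) := by
    refine antitoneOn_of_deriv_nonpos (convex_Icc 0 1)
      (fun x _ => (hH' x).continuousAt.continuousWithinAt)
      (fun x _ => (hH' x).differentiableAt.differentiableWithinAt) fun x hx => ?_
    rw [interior_Icc] at hx
    have hx0 : 0 < x := hx.1
    rw [(hH' x).deriv]
    have key := sum_mul_pow_le_of_convolution_le hp hrec N hx0.le
    have e1 : ∑ m ∈ range (N + 1), m * p m * x ^ m =
        x * ∑ m ∈ range (N + 1), p m * (m * x ^ (m - 1)) := by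
      rw [Finset.mul_sum]
      refine Finset.sum_congr rfl fun m _ => ?_
      rcases m with _ | m
      · simp
      · rw [Nat.add_sub_cancel, pow_succ]; ring
    have e2 : ∑ k ∈ Icc 1 N \ A, x ^ k =
        x * ∑ k ∈ Icc 1 N \ A, k * x ^ (k - 1) * (k : ℝ)⁻¹ := by
      rw [Finset.mul_sum]
      refine Finset.sum_congr rfl fun k hk => ?_
      have hk1 : 1 ≤ k := (mem_Icc.1 (mem_sdiff.1 hk).1).1
      obtain ⟨j, rfl⟩ : ∃ j, k = j + 1 := ⟨k - 1, by omega⟩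
      have : ((j + 1 : ℕ) : ℝ) ≠ 0 := by positivity
      rw [Nat.add_sub_cancel, pow_succ]
      field_simp
    rw [e1, e2, mul_assoc] at key
    have key2 := le_of_mul_le_mul_left key hx0
    have hexp := Real.exp_pos (-G x)
    have : (∑ m ∈ range (N + 1), p m * (m * x ^ (m - 1)) -
        (∑ k ∈ Icc 1 N \ A, k * x ^ (k - 1) * (k : ℝ)⁻¹) * F x) * Real.exp (-G x) ≤ 0 :=
      mul_nonpos_of_nonpos_of_nonneg (by linarith) hexp.le
    linarith
  have h01 := hanti (Set.left_mem_Icc.2 zero_le_one) (Set.right_mem_Icc.2 zero_le_one) zero_le_one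
  have hF0 : F 0 = 1 := by
    simp only [hF]
    rw [Finset.sum_eq_single 0]
    · simp [hp0]
    · intro m _ hm; simp [hm]
    · simp
  have hG0 : G 0 = 0 := by
    simp only [hG]
    refine Finset.sum_eq_zero fun k hk => ?_
    have hk1 : 1 ≤ k := (mem_Icc.1 (mem_sdiff.1 hk).1).1
    rw [zero_pow (by omega), zero_mul]
  have hF1 : F 1 = ∑ m ∈ range (N + 1), p m := by simp [hF]
  have hG1 : G 1 = ∑ k ∈ Icc 1 N \ A, (k : ℝ)⁻¹ := by simp [hG]
  simp only [hF0, hG0, hF1, hG1, neg_zero, Real.exp_zero, mul_one] at h01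
  rwa [Real.exp_neg, ← div_eq_mul_inv, div_le_one (Real.exp_pos _)] at h01

/-- The proportion of permutations of `n` points without a cycle whose length lies in `A`. -/
noncomputable def avoidProp (A : Finset ℕ) (n : ℕ) : ℝ :=
  permAvg n fun m => if ∀ k ∈ m, k ∉ A then 1 else 0

theorem avoidProp_nonneg (A : Finset ℕ) (n : ℕ) : 0 ≤ avoidProp A n :=
  permAvg_nonneg fun _ => by split_ifs <;> norm_num

theorem avoidProp_zero (A : Finset ℕ) : avoidProp A 0 = 1 := by
  have h : ∀ σ : Equiv.Perm (Fin 0), σ.cycleType = 0 := fun σ => by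
    rw [Subsingleton.elim σ 1, Equiv.Perm.cycleType_one]
  simp [avoidProp, permAvg, h]

/-- Classify the pairs of a permutation and a point by the length of the cycle through the
point. -/
theorem mul_avoidProp_le {A : Finset ℕ} (hA : ∀ k ∈ A, 2 ≤ k) {n : ℕ} (hn : 0 < n) :
    n * avoidProp A n ≤ ∑ k ∈ Icc 1 n \ A, avoidProp A (n - k) := by
  set g : Multiset ℕ → ℝ := fun m => if ∀ k ∈ m, k ∉ A then 1 else 0 with hg
  have hg0 : ∀ m, 0 ≤ g m := fun m => by simp only [hg]; split_ifs <;> norm_num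
  obtain ⟨n, rfl⟩ : ∃ j, n = j + 1 := ⟨n - 1, by omega⟩
  have hone : 1 ∉ A := fun h => by have := hA 1 h; omega
  have hsplit : Icc 1 (n + 1) \ A = insert 1 (Icc 2 (n + 1) \ A) := by
    ext k
    simp only [mem_sdiff, mem_Icc, mem_insert]
    constructor
    · rintro ⟨⟨h1, h2⟩, h3⟩
      rcases eq_or_ne k 1 with h | h
      · exact Or.inl h
      · exact Or.inr ⟨⟨by omega, h2⟩, h3⟩
    · rintro (rfl | ⟨⟨h1, h2⟩, h3⟩)
      · exact ⟨⟨le_rfl, by omega⟩, hone⟩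
      · exact ⟨⟨by omega, h2⟩, h3⟩
  calc ((n + 1 : ℕ) : ℝ) * avoidProp A (n + 1)
      = permAvg (n + 1) (fun m => ((n + 1 : ℕ) : ℝ) * g m) := by rw [permAvg_const_mul]; rfl
    _ ≤ permAvg (n + 1) (fun m => ((n + 1 : ℕ) - m.sum : ℝ) * g m +
          ∑ k ∈ Icc 2 (n + 1) \ A, k * (m.count k * g (m.erase k))) := by
        refine permAvg_mono fun m hm => ?_
        rw [mem_cycleTypes] at hm
        have hpos : 0 ≤ ∑ k ∈ Icc 2 (n + 1) \ A, (k : ℝ) * (m.count k * g (m.erase k)) :=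
          Finset.sum_nonneg fun k _ => by have := hg0 (m.erase k); positivity
        by_cases hm1 : ∀ k ∈ m, k ∉ A
        · have hgm : g m = 1 := if_pos hm1
          have hsum : (m.sum : ℝ) ≤
              ∑ k ∈ Icc 2 (n + 1) \ A, (k : ℝ) * (m.count k * g (m.erase k)) := by
            rw [Finset.sum_multiset_count m]
            push_cast
            calc ∑ k ∈ m.toFinset, ((m.count k • k : ℕ) : ℝ)
                = ∑ k ∈ m.toFinset, (k : ℝ) * (m.count k * g (m.erase k)) := by
                  refine Finset.sum_congr rfl fun k _ => ?_
                  have : g (m.erase k) = 1 :=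
                    if_pos fun j hj => hm1 j (Multiset.mem_of_mem_erase hj)
                  rw [this, smul_eq_mul]
                  push_cast
                  ring
              _ ≤ _ := by
                  refine Finset.sum_le_sum_of_subset_of_nonneg (fun k hk => ?_) fun k _ _ => by
                    have := hg0 (m.erase k); positivity
                  rw [Multiset.mem_toFinset] at hk
                  have h1 := Multiset.single_le_sum (fun _ _ => Nat.zero_le _) _ hk
                  exact mem_sdiff.2 ⟨mem_Icc.2 ⟨hm.2 k hk, by omega⟩, hm1 k hk⟩
          rw [hgm, mul_one, mul_one]
          linarith
        · have hgm : g m = 0 := if_neg hm1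
          rw [hgm, mul_zero, mul_zero, zero_add]
          exact hpos
    _ = avoidProp A n + ∑ k ∈ Icc 2 (n + 1) \ A, avoidProp A (n + 1 - k) := by
        rw [permAvg_add, permAvg_fixedPoints_mul, permAvg_sum]
        congr 1
        refine Finset.sum_congr rfl fun k hk => ?_
        obtain ⟨h2, h3⟩ := mem_Icc.1 (mem_sdiff.1 hk).1
        have hk0 : (k : ℝ) ≠ 0 := by positivity
        rw [permAvg_const_mul, permAvg_count_mul_erase h2 h3, ← mul_assoc, mul_inv_cancel₀ hk0,
          one_mul]
        rfl
    _ = ∑ k ∈ Icc 1 (n + 1) \ A, avoidProp A (n + 1 - k) := by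
        rw [hsplit, Finset.sum_insert (by simp), Nat.add_sub_cancel]

theorem avoidProp_le {A : Finset ℕ} {n : ℕ} (hn : 0 < n) (hA : ∀ k ∈ A, 2 ≤ k ∧ k ≤ n) :
    avoidProp A n ≤ Real.exp 1 * Real.exp (-∑ k ∈ A, (k : ℝ)⁻¹) := by
  have hn' : (0 : ℝ) < n := by exact_mod_cast hn
  have hrec : ∀ m : ℕ, 0 < m → m * avoidProp A m ≤ ∑ k ∈ Icc 1 m \ A, avoidProp A (m - k) :=
    fun m hm => mul_avoidProp_le (fun k hk => (hA k hk).1) hm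
  have h1 : n * avoidProp A n ≤ ∑ m ∈ range (n + 1), avoidProp A m := by
    refine (hrec n hn).trans ?_
    rw [← Finset.sum_range_reflect, Nat.add_sub_cancel]
    refine Finset.sum_le_sum_of_subset_of_nonneg (fun k hk => ?_) fun _ _ _ => avoidProp_nonneg _ _
    have := (mem_Icc.1 (mem_sdiff.1 hk).1).2
    exact mem_range.2 (by omega)
  have h2 := sum_le_exp_of_convolution_le (avoidProp_nonneg A) (avoidProp_zero A) hrec n
  have hsub : A ⊆ Icc 1 n := fun k hk =>
    mem_Icc.2 ⟨(by norm_num : 1 ≤ 2).trans (hA k hk).1, (hA k hk).2⟩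
  have h3 : ∑ k ∈ Icc 1 n \ A, (k : ℝ)⁻¹ ≤ 1 + Real.log n + -∑ k ∈ A, (k : ℝ)⁻¹ := by
    have h4 := Finset.sum_sdiff hsub (f := fun k : ℕ => (k : ℝ)⁻¹)
    have h5 := harmonic_le_one_add_log n
    rw [harmonic_eq_sum_Icc] at h5
    push_cast at h5
    linarith
  have h6 : n * avoidProp A n ≤ n * (Real.exp 1 * Real.exp (-∑ k ∈ A, (k : ℝ)⁻¹)) :=
    calc n * avoidProp A n ≤ Real.exp (1 + Real.log n + -∑ k ∈ A, (k : ℝ)⁻¹) :=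
          (h1.trans h2).trans (Real.exp_le_exp.2 h3)
      _ = _ := by rw [Real.exp_add, Real.exp_add, Real.exp_log hn']; ring
  exact le_of_mul_le_mul_left h6 hn'

/-! ### Permutations with a `p`-cycle and a further cycle of length divisible by `p` -/

open Classical in
theorem permAvg_exists_mem_erase_dvd_le {p : ℕ} (hp : 2 ≤ p) {n : ℕ} :
    permAvg n (fun m => if p ∈ m ∧ ∃ q ∈ m.erase p, p ∣ q then 1 else 0) ≤
      (1 + Real.log n) * ((p : ℝ) ^ 2)⁻¹ := by
  have hp0 : (0 : ℝ) < p := by positivity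
  have hlog : 0 ≤ 1 + Real.log n := by linarith [Real.log_natCast_nonneg n]
  set h : Multiset ℕ → ℝ := fun m => ∑ j ∈ Icc 1 n, (m.count (j * p) : ℝ) with hh
  have hh0 : ∀ m, 0 ≤ h m := fun m => Finset.sum_nonneg fun _ _ => by positivity
  have h1 : permAvg n (fun m => if p ∈ m ∧ ∃ q ∈ m.erase p, p ∣ q then 1 else 0) ≤
      permAvg n (fun m => m.count p * h (m.erase p)) := by
    refine permAvg_mono fun m hm => ?_
    rw [mem_cycleTypes] at hm
    split_ifs with hc
    · obtain ⟨hpm, q, hq, j, rfl⟩ := hc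
      have hqm := Multiset.mem_of_mem_erase hq
      have hqn := Multiset.single_le_sum (fun _ _ => Nat.zero_le _) _ hqm
      have hq2 := hm.2 _ hqm
      have hj0 : 0 < j := Nat.pos_of_ne_zero fun h0 => by
        rw [h0, mul_zero] at hq2
        omega
      have hjn : j ≤ n := (Nat.le_mul_of_pos_left j (by omega)).trans (hqn.trans hm.1)
      have c1 : (1 : ℝ) ≤ m.count p := by exact_mod_cast Multiset.one_le_count_iff_mem.2 hpm
      have c2 : (1 : ℝ) ≤ h (m.erase p) := by
        have c3 : (1 : ℝ) ≤ (m.erase p).count (j * p) := by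
          rw [mul_comm]
          exact_mod_cast Multiset.one_le_count_iff_mem.2 hq
        exact c3.trans (Finset.single_le_sum
          (f := fun j => ((m.erase p).count (j * p) : ℝ)) (fun _ _ => by positivity)
          (mem_Icc.2 ⟨hj0, hjn⟩))
      nlinarith
    · have := hh0 (m.erase p)
      positivity
  refine h1.trans ?_
  rcases le_or_gt p n with hpn | hpn
  · rw [permAvg_count_mul_erase hp hpn, permAvg_sum]
    have h2 : ∑ j ∈ Icc 1 n, permAvg (n - p) (fun m => (m.count (j * p) : ℝ)) ≤
        ∑ j ∈ Icc 1 n, (p : ℝ)⁻¹ * (j : ℝ)⁻¹ := by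
      refine Finset.sum_le_sum fun j hj => ?_
      have hj1 := (mem_Icc.1 hj).1
      refine (permAvg_count_le _ (hp.trans (Nat.le_mul_of_pos_left p hj1))).trans ?_
      push_cast
      rw [mul_inv, mul_comm]
    have h3 := harmonic_le_one_add_log n
    rw [harmonic_eq_sum_Icc] at h3
    push_cast at h3
    rw [← Finset.mul_sum] at h2
    calc (p : ℝ)⁻¹ * ∑ j ∈ Icc 1 n, permAvg (n - p) (fun m => (m.count (j * p) : ℝ))
        ≤ (p : ℝ)⁻¹ * ((p : ℝ)⁻¹ * (1 + Real.log n)) := by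
          refine mul_le_mul_of_nonneg_left (h2.trans ?_) (by positivity)
          exact mul_le_mul_of_nonneg_left h3 (by positivity)
      _ = _ := by rw [pow_two, mul_inv]; ring
  · calc permAvg n (fun m => m.count p * h (m.erase p))
        ≤ permAvg n (fun m => 0 * (m.count p * h (m.erase p))) := by
          refine permAvg_mono fun m hm => ?_
          have : p ∉ m := fun hpm => by
            have := Multiset.single_le_sum (fun _ _ => Nat.zero_le _) _ hpm
            have := (mem_cycleTypes.1 hm).1
            omega
          simp [Multiset.count_eq_zero_of_notMem this]
      _ = 0 := by rw [permAvg_const_mul, zero_mul]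
      _ ≤ _ := by positivity

theorem sum_Ioc_inv_sq_le {u : ℕ} (hu : 0 < u) (v : ℕ) :
    ∑ k ∈ Ioc u v, ((k : ℝ) ^ 2)⁻¹ ≤ (u : ℝ)⁻¹ := by
  rcases le_or_gt u v with h | h
  · have := sum_Ioc_inv_sq_le_sub (α := ℝ) hu.ne' h
    have : 0 ≤ (v : ℝ)⁻¹ := by positivity
    linarith
  · rw [Finset.Ioc_eq_empty (by omega)]
    simp

/-- The cycle type `m` has exactly one part divisible by `p`, and this part is `p`. -/
def HasUniqueMultiple (p : ℕ) (m : Multiset ℕ) : Prop :=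
  p ∈ m ∧ ∀ q ∈ m.erase p, ¬ p ∣ q

open Classical in
/-- A permutation fails to have a prime `p ∈ (u, v]` with `HasUniqueMultiple p` either because it
has no cycle of such a prime length at all, or because it has one together with a second cycle of
length divisible by the same prime. -/
theorem permAvg_not_hasUniqueMultiple_le {n u v : ℕ} (hu : 0 < u) (hvn : v ≤ n) (hn : 0 < n) :
    permAvg n (fun m => if ∃ p ∈ (Ioc u v).filter Nat.Prime, HasUniqueMultiple p m then 0 else 1) ≤
      Real.exp 1 * Real.exp (-∑ p ∈ (Ioc u v).filter Nat.Prime, (p : ℝ)⁻¹) +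
        (1 + Real.log n) / u := by
  set A := (Ioc u v).filter Nat.Prime with hAdef
  have hA : ∀ k ∈ A, 2 ≤ k ∧ k ≤ n := fun k hk => by
    rw [hAdef, mem_filter, mem_Ioc] at hk
    exact ⟨hk.2.two_le, hk.1.2.trans hvn⟩
  have hlog : 0 ≤ 1 + Real.log n := by linarith [Real.log_natCast_nonneg n]
  calc permAvg n (fun m => if ∃ p ∈ A, HasUniqueMultiple p m then 0 else 1)
      ≤ permAvg n (fun m => (if ∀ k ∈ m, k ∉ A then 1 else 0) +
          ∑ p ∈ A, if p ∈ m ∧ ∃ q ∈ m.erase p, p ∣ q then 1 else 0) := by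
        refine permAvg_mono fun m _ => ?_
        have h2 : ∀ p ∈ A, (0 : ℝ) ≤ if p ∈ m ∧ ∃ q ∈ m.erase p, p ∣ q then 1 else 0 :=
          fun p _ => by split_ifs <;> norm_num
        have h3 := Finset.sum_nonneg h2
        have h4 : (0 : ℝ) ≤ if ∀ k ∈ m, k ∉ A then 1 else 0 := by split_ifs <;> norm_num
        by_cases hgood : ∃ p ∈ A, HasUniqueMultiple p m
        · rw [if_pos hgood]
          exact add_nonneg h4 h3
        · rw [if_neg hgood]
          by_cases hav : ∀ k ∈ m, k ∉ A
          · rw [if_pos hav]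
            linarith
          · push Not at hav
            obtain ⟨p, hpm, hpA⟩ := hav
            have hbad : p ∈ m ∧ ∃ q ∈ m.erase p, p ∣ q := by
              refine ⟨hpm, ?_⟩
              by_contra hq
              push Not at hq
              exact hgood ⟨p, hpA, hpm, hq⟩
            have h5 := Finset.single_le_sum h2 hpA
            rw [if_pos hbad] at h5
            linarith
    _ = avoidProp A n +
          ∑ p ∈ A, permAvg n (fun m => if p ∈ m ∧ ∃ q ∈ m.erase p, p ∣ q then 1 else 0) := by
        rw [permAvg_add, permAvg_sum]
        rfl
    _ ≤ Real.exp 1 * Real.exp (-∑ p ∈ A, (p : ℝ)⁻¹) +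
          ∑ p ∈ A, (1 + Real.log n) * ((p : ℝ) ^ 2)⁻¹ :=
        add_le_add (avoidProp_le hn hA)
          (Finset.sum_le_sum fun p hp => permAvg_exists_mem_erase_dvd_le (hA p hp).1)
    _ ≤ _ := by
        rw [← Finset.mul_sum, div_eq_mul_inv]
        gcongr
        exact (Finset.sum_le_sum_of_subset_of_nonneg (Finset.filter_subset _ _)
          fun _ _ _ => by positivity).trans (sum_Ioc_inv_sq_le hu v)

/-! ### Powers that are cycles of prime length -/

/-- If a cycle of prime length `p` is the only cycle of `σ` of length divisible by `p`, then the
power of `σ` by the order of the remaining part of `σ` kills that part and keeps a `p`-cycle. -/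
theorem isPreCycle_of_hasUniqueMultiple {n p : ℕ} (hp : p.Prime) {σ : Equiv.Perm (Fin n)}
    (h : HasUniqueMultiple p σ.cycleType) : IsPreCycle p σ := by
  obtain ⟨hpm, hq⟩ := h
  obtain ⟨c, τ, rfl, hd, hc, hcp⟩ := Equiv.Perm.mem_cycleType_iff.1 hpm
  have hct : (c * τ).cycleType = p ::ₘ τ.cycleType := by
    rw [hd.cycleType_mul, hc.cycleType, hcp]
    rfl
  rw [hct, Multiset.erase_cons_head] at hq
  have hcop : Nat.Coprime (orderOf τ) (orderOf c) := by
    rw [hc.orderOf, hcp, Nat.coprime_comm, hp.coprime_iff_not_dvd, ← Equiv.Perm.lcm_cycleType]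
    intro hdvd
    have key : ∀ s : Multiset ℕ, p ∣ s.lcm → ∃ q ∈ s, p ∣ q := by
      intro s
      induction s using Multiset.induction_on with
      | empty =>
        intro h1
        rw [Multiset.lcm_zero, Nat.dvd_one] at h1
        exact absurd h1 hp.ne_one
      | cons a s ih =>
        intro h1
        rw [Multiset.lcm_cons] at h1
        rcases (hp.dvd_mul).1 (h1.trans (Nat.lcm_dvd_mul a s.lcm)) with h2 | h2
        · exact ⟨a, Multiset.mem_cons_self a s, h2⟩
        · obtain ⟨q, hqs, hpq⟩ := ih h2
          exact ⟨q, Multiset.mem_cons_of_mem hqs, hpq⟩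
    obtain ⟨q, hqm, hpq⟩ := key _ hdvd
    exact hq q hqm hpq
  have hpow : (c * τ) ^ orderOf τ = c ^ orderOf τ := by
    rw [hd.commute.mul_pow, pow_orderOf_eq_one, mul_one]
  refine ⟨orderOf τ, ?_, ?_⟩
  · rw [hpow]
    exact hc.pow_iff.2 hcop
  · rw [hpow, Equiv.Perm.support_pow_coprime hcop, hcp]

/-! ### Choice of the range of primes and the final estimates -/

/-- The lower end `⌈t² exp t⌉` of the range of primes used when `log log n = t`. The factor `t²`
makes the exceptional permutations with two cycles of length divisible by `p` negligible, and
barely changes `log log` of the end point. -/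
noncomputable def lowerEnd (t : ℝ) : ℕ := ⌈t ^ 2 * Real.exp t⌉₊

/-- The upper end of the range of primes used when `log log n = t`: it is an integer strictly
below `exp (t²) = (log n) ^ t`. -/
noncomputable def upperEnd (t : ℝ) : ℕ := ⌊Real.exp (t ^ 2)⌋₊ - 1

theorem upperEnd_lt {t : ℝ} : (upperEnd t : ℝ) < Real.exp (t ^ 2) := by
  have h1 : 1 ≤ ⌊Real.exp (t ^ 2)⌋₊ := Nat.floor_pos.2 (Real.one_le_exp (sq_nonneg t))
  have h2 := Nat.floor_le (Real.exp_pos (t ^ 2)).le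
  rw [upperEnd, Nat.cast_sub h1]
  push_cast
  linarith

theorem le_log_upperEnd {t : ℝ} (ht : 20 ≤ t) : 19 / 20 * t ^ 2 ≤ Real.log (upperEnd t) := by
  have h1 : 1 ≤ ⌊Real.exp (t ^ 2)⌋₊ := Nat.floor_pos.2 (Real.one_le_exp (sq_nonneg t))
  have h2 := Nat.lt_floor_add_one (Real.exp (t ^ 2))
  have h3 : Real.exp (t ^ 2) = Real.exp (19 / 20 * t ^ 2) * Real.exp (1 / 20 * t ^ 2) := by
    rw [← Real.exp_add]; ring_nf
  have h4 := Real.add_one_le_exp (1 / 20 * t ^ 2)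
  have h5 : 1 ≤ Real.exp (19 / 20 * t ^ 2) := Real.one_le_exp (by positivity)
  have h6 : Real.exp (19 / 20 * t ^ 2) ≤ upperEnd t := by
    rw [upperEnd, Nat.cast_sub h1]
    push_cast
    nlinarith
  rw [← Real.log_exp (19 / 20 * t ^ 2)]
  exact Real.log_le_log (Real.exp_pos _) h6

theorem le_log_lowerEnd {t : ℝ} (ht : 1 ≤ t) : t ≤ Real.log (lowerEnd t) := by
  have h1 : Real.exp t ≤ lowerEnd t :=
    le_trans (le_mul_of_one_le_left (Real.exp_pos t).le (by nlinarith)) (Nat.le_ceil _)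
  conv_lhs => rw [← Real.log_exp t]
  exact Real.log_le_log (Real.exp_pos _) h1

theorem log_lowerEnd_le {t : ℝ} (ht : 20 ≤ t) (h : t ^ 2 ≤ 1 / 2 * Real.exp (1 / 20 * t)) :
    Real.log (lowerEnd t) ≤ 21 / 20 * t := by
  have h1 : (lowerEnd t : ℝ) < t ^ 2 * Real.exp t + 1 := Nat.ceil_lt_add_one (by positivity)
  have h2 : Real.exp (21 / 20 * t) = Real.exp (1 / 20 * t) * Real.exp t := by
    rw [← Real.exp_add]; ring_nf
  have h3 := Real.add_one_le_exp (21 / 20 * t)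
  have h4 : t ^ 2 * Real.exp t ≤ 1 / 2 * Real.exp (1 / 20 * t) * Real.exp t := by gcongr
  have h5 : (lowerEnd t : ℝ) ≤ Real.exp (21 / 20 * t) := by nlinarith
  have h6 : (0 : ℝ) < lowerEnd t := by
    have : 0 < lowerEnd t := Nat.ceil_pos.2 (by positivity)
    exact_mod_cast this
  rw [← Real.log_exp (21 / 20 * t)]
  exact Real.log_le_log h6 h5

/-- The two error terms of `permAvg_not_hasUniqueMultiple_le` sum to at most `(e + o(1)) / t`: by
Mertens' theorem the sum of the reciprocals of the primes in the range is `log t + o(1)`. -/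
theorem eventually_error_le : ∀ᶠ t : ℝ in Filter.atTop,
    Real.exp 1 * Real.exp (-∑ p ∈ (Ioc (lowerEnd t) (upperEnd t)).filter Nat.Prime, (p : ℝ)⁻¹) +
      (1 + Real.exp t) / lowerEnd t ≤ 7 / 2 / t := by
  obtain ⟨C, hC, hMertens⟩ := exists_le_sum_inv_primes
  have hlittle := (isLittleO_pow_exp_pos_mul_atTop 2 (b := 1 / 20) (by norm_num)).bound
    (c := 1 / 2) (by norm_num)
  filter_upwards [hlittle, Filter.eventually_ge_atTop 20,
    Filter.eventually_ge_atTop (20 * C)] with t ht1 ht20 htC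
  have ht0 : 0 < t := by linarith
  rw [Real.norm_of_nonneg (by positivity), Real.norm_of_nonneg (Real.exp_pos _).le] at ht1
  have hu1 := le_log_lowerEnd (t := t) (by linarith)
  have hu2 := log_lowerEnd_le ht20 ht1
  have hv := le_log_upperEnd ht20
  -- `lowerEnd t ≤ exp (21 t / 20)` and `upperEnd t ≥ exp (19 t² / 20)`; the loss of these constants
  -- and of `C / log u` is affordable because `e * (20 / 19) * (21 / 19) + 1 / 10 < 7 / 2`.
  have hu0 : t ^ 2 * Real.exp t ≤ lowerEnd t := Nat.le_ceil _
  have hupos : (0 : ℝ) < lowerEnd t := lt_of_lt_of_le (by positivity) hu0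
  have hu : 2 ≤ lowerEnd t := by
    have h1 : (2 : ℝ) ≤ lowerEnd t := by
      have := Real.log_le_sub_one_of_pos hupos
      linarith
    exact_mod_cast h1
  have huv : lowerEnd t ≤ upperEnd t := by
    have h1 : Real.log (lowerEnd t) < Real.log (upperEnd t) := by nlinarith
    have h2 : (lowerEnd t : ℝ) < upperEnd t := by
      by_contra hcon
      push Not at hcon
      rcases Nat.eq_zero_or_pos (upperEnd t) with h0 | h0
      · rw [h0, Nat.cast_zero, Real.log_zero] at h1
        linarith
      · have := Real.log_le_log (by exact_mod_cast h0) hcon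
        linarith
    exact_mod_cast h2.le
  have hM := hMertens _ _ hu huv
  set μ := ∑ p ∈ (Ioc (lowerEnd t) (upperEnd t)).filter Nat.Prime, (p : ℝ)⁻¹
  have hlogv : Real.log (19 / 20) + 2 * Real.log t ≤ Real.log (Real.log (upperEnd t)) := by
    have h1 := Real.log_le_log (by positivity) hv
    rw [Real.log_mul (by norm_num) (by positivity), Real.log_pow] at h1
    exact_mod_cast h1
  have hlogu : Real.log (Real.log (lowerEnd t)) ≤ Real.log (21 / 20) + Real.log t := by
    have h1 := Real.log_le_log (by linarith) hu2
    rwa [Real.log_mul (by norm_num) (by positivity)] at h1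
  have hCu : C / Real.log (lowerEnd t) ≤ 1 / 20 := by
    rw [div_le_iff₀ (by linarith)]
    linarith
  have hμ : -μ ≤ 1 / 20 + (Real.log (21 / 20) - Real.log (19 / 20)) - Real.log t := by linarith
  have hexp : Real.exp (-μ) ≤ Real.exp (1 / 20) * (21 / 19) / t := by
    refine (Real.exp_le_exp.2 hμ).trans (le_of_eq ?_)
    rw [Real.exp_sub, Real.exp_add, Real.exp_sub, Real.exp_log (by norm_num),
      Real.exp_log (by norm_num), Real.exp_log ht0]
    norm_num
  have hexp20 : Real.exp (1 / 20) ≤ 20 / 19 := by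
    have h1 := Real.add_one_le_exp (-(1 / 20) : ℝ)
    rw [Real.exp_neg] at h1
    have h2 := Real.exp_pos (1 / 20)
    have h3 : (19 / 20 : ℝ) ≤ (Real.exp (1 / 20))⁻¹ := by linarith
    rw [le_inv_comm₀ (by norm_num) h2] at h3
    norm_num at h3
    exact h3
  have he := Real.exp_one_lt_d9
  have h1 : Real.exp 1 * Real.exp (-μ) ≤ 2.7182818286 * (20 / 19 * (21 / 19) / t) := by
    have : Real.exp (-μ) ≤ 20 / 19 * (21 / 19) / t := hexp.trans (by gcongr)
    gcongr
  have h2 : (1 + Real.exp t) / lowerEnd t ≤ 1 / 10 / t := by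
    calc (1 + Real.exp t) / lowerEnd t ≤ (2 * Real.exp t) / (t ^ 2 * Real.exp t) := by
          have := Real.add_one_le_exp t
          gcongr
          linarith
      _ = 2 / t / t := by field_simp
      _ ≤ 1 / 10 / t := by
          refine div_le_div_of_nonneg_right ?_ ht0.le
          rw [div_le_iff₀ ht0]
          linarith
  calc _ ≤ 2.7182818286 * (20 / 19 * (21 / 19) / t) + 1 / 10 / t := add_le_add h1 h2
    _ = (2.7182818286 * (20 / 19 * (21 / 19)) + 1 / 10) / t := by ring
    _ ≤ 7 / 2 / t := by gcongr; norm_num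

theorem powersToSmallPrimeCycle_of_hasUniqueMultiple {n : ℕ} {t : ℝ} (ht : 1 ≤ t)
    (hn : Real.exp t = Real.log n) {σ : Equiv.Perm (Fin n)}
    (h : ∃ p ∈ (Ioc (lowerEnd t) (upperEnd t)).filter Nat.Prime,
      HasUniqueMultiple p σ.cycleType) : PowersToSmallPrimeCycle σ := by
  obtain ⟨p, hp, hu⟩ := h
  rw [mem_filter, mem_Ioc] at hp
  refine ⟨p, hp.2, ?_, ?_, isPreCycle_of_hasUniqueMultiple hp.2 hu⟩
  · have h1 : Real.exp t ≤ lowerEnd t :=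
      le_trans (le_mul_of_one_le_left (Real.exp_pos t).le (by nlinarith)) (Nat.le_ceil _)
    rw [← hn]
    exact lt_of_le_of_lt h1 (by exact_mod_cast hp.1.1)
  · have h1 : (p : ℝ) ≤ upperEnd t := by exact_mod_cast hp.1.2
    rw [← hn, Real.log_exp, ← Real.exp_mul, ← pow_two]
    exact h1.trans_lt upperEnd_lt

open Classical in
/-- All but `(7/2) / log log n` of the permutations have the required power. The constant is at
most half of `7`, so the same count also serves the alternating group. -/
theorem eventually_card_not_powersToSmallPrimeCycle_le : ∀ᶠ n : ℕ in Filter.atTop,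
    (#{σ : Equiv.Perm (Fin n) | ¬ PowersToSmallPrimeCycle σ} : ℝ) ≤
      7 / 2 / Real.log (Real.log n) * n.factorial := by
  have hlog : Filter.Tendsto (fun n : ℕ => Real.log n) Filter.atTop Filter.atTop :=
    Real.tendsto_log_atTop.comp tendsto_natCast_atTop_atTop
  have hloglog := Real.tendsto_log_atTop.comp hlog
  have hsq := (Real.isLittleO_pow_exp_atTop (n := 2)).bound (c := 1) (by norm_num)
  filter_upwards [hloglog.eventually eventually_error_le, hloglog.eventually hsq,
    hloglog.eventually (Filter.eventually_ge_atTop 1),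
    hlog.eventually (Filter.eventually_gt_atTop 0),
    Filter.eventually_gt_atTop 0] with n herr hn2 hn1 hn0 hnpos
  simp only [Function.comp_apply] at herr hn2 hn1
  have hexp : Real.exp (Real.log (Real.log n)) = Real.log n := Real.exp_log hn0
  set t := Real.log (Real.log n) with ht
  have hn' : (0 : ℝ) < n := by exact_mod_cast hnpos
  rw [Real.norm_of_nonneg (by positivity), Real.norm_of_nonneg (Real.exp_pos _).le, one_mul,
    hexp] at hn2
  have hvn : upperEnd t ≤ n := by
    have h1 : Real.exp (t ^ 2) ≤ n := by
      rw [← Real.exp_log hn']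
      exact Real.exp_le_exp.2 hn2
    exact_mod_cast (upperEnd_lt.trans_le h1).le
  have hu : 0 < lowerEnd t := Nat.ceil_pos.2 (by positivity)
  have hbad := permAvg_not_hasUniqueMultiple_le hu hvn hnpos
  rw [← hexp] at hbad
  have hle := hbad.trans herr
  rw [permAvg, div_le_iff₀ (by positivity)] at hle
  refine le_trans ?_ hle
  rw [Finset.card_filter]
  push_cast
  refine Finset.sum_le_sum fun σ _ => ?_
  by_cases h : ∃ p ∈ (Ioc (lowerEnd t) (upperEnd t)).filter Nat.Prime,
      HasUniqueMultiple p σ.cycleType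
  · have := powersToSmallPrimeCycle_of_hasUniqueMultiple hn1 hexp h
    rw [if_pos h, if_neg (not_not.2 this)]
  · rw [if_neg h]
    split_ifs <;> norm_num

open Classical in
theorem one_sub_le_rho {n : ℕ} {ε : ℝ} (G : Subgroup (Equiv.Perm (Fin n)))
    (h : (#{σ : Equiv.Perm (Fin n) | ¬ PowersToSmallPrimeCycle σ} : ℝ) ≤ ε * Nat.card G) :
    1 - ε ≤ rho G := by
  have hG : (0 : ℝ) < Nat.card G := by exact_mod_cast Nat.card_pos
  have hsplit : Nat.card {g : G // PowersToSmallPrimeCycle (g : Equiv.Perm (Fin n))} +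
      Nat.card {g : G // ¬ PowersToSmallPrimeCycle (g : Equiv.Perm (Fin n))} = Nat.card G := by
    rw [← Nat.card_sum]
    exact Nat.card_congr (Equiv.sumCompl _)
  have hle : Nat.card {g : G // ¬ PowersToSmallPrimeCycle (g : Equiv.Perm (Fin n))} ≤
      #{σ : Equiv.Perm (Fin n) | ¬ PowersToSmallPrimeCycle σ} := by
    rw [← Fintype.card_subtype, ← Nat.card_eq_fintype_card]
    exact Nat.card_le_card_of_injective
      (fun g => (⟨g.1.1, g.2⟩ : {σ : Equiv.Perm (Fin n) // ¬ PowersToSmallPrimeCycle σ}))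
      fun a b hab => Subtype.ext (Subtype.ext (Subtype.mk.inj hab))
  have hsplit' : (Nat.card {g : G // PowersToSmallPrimeCycle (g : Equiv.Perm (Fin n))} : ℝ) +
      Nat.card {g : G // ¬ PowersToSmallPrimeCycle (g : Equiv.Perm (Fin n))} = Nat.card G := by
    exact_mod_cast hsplit
  have hle' : (Nat.card {g : G // ¬ PowersToSmallPrimeCycle (g : Equiv.Perm (Fin n))} : ℝ) ≤
      #{σ : Equiv.Perm (Fin n) | ¬ PowersToSmallPrimeCycle σ} := by exact_mod_cast hle
  rw [rho, le_div_iff₀ hG]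
  linarith

theorem theorem1 :
    ∃ N : ℕ, ∀ n : ℕ, N ≤ n →
      rho (⊤ : Subgroup (Equiv.Perm (Fin n))) ≥ 1 - 5 / Real.log (Real.log n) ∧
      rho (alternatingGroup (Fin n)) ≥ 1 - 7 / Real.log (Real.log n) := by
  have hlog : Filter.Tendsto (fun n : ℕ => Real.log (Real.log n)) Filter.atTop Filter.atTop :=
    Real.tendsto_log_atTop.comp (Real.tendsto_log_atTop.comp tendsto_natCast_atTop_atTop)
  refine Filter.eventually_atTop.1 ?_
  filter_upwards [eventually_card_not_powersToSmallPrimeCycle_le,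
    hlog.eventually (Filter.eventually_gt_atTop 0), Filter.eventually_ge_atTop 2] with n hn ht hn2
  refine ⟨one_sub_le_rho _ (hn.trans ?_), one_sub_le_rho _ (hn.trans (le_of_eq ?_))⟩
  · rw [Subgroup.card_top, Nat.card_perm, Nat.card_eq_fintype_card, Fintype.card_fin]
    gcongr
    norm_num
  · have : Nontrivial (Fin n) := Fin.nontrivial_iff_two_le.2 hn2
    -- The alternating group has index two, so the bound on the proportion doubles.
    have h2 : 2 * Nat.card (alternatingGroup (Fin n)) = n.factorial := by
      rw [two_mul_nat_card_alternatingGroup, Nat.card_perm, Nat.card_eq_fintype_card,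
        Fintype.card_fin]
    have h2' : (n.factorial : ℝ) = 2 * Nat.card (alternatingGroup (Fin n)) := by
      exact_mod_cast h2.symm
    rw [h2']
    ring
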